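/- **Setting.** Let $n\ge 1$, $d\ge 0$. The partition monoid $\mathcal P_n$ consists of the set partitions of $\{1,\dots,n\}\cup\{1',\dots,n'\}$. For $\alpha,\beta\in\mathcal P_n$ the product graph $\Gamma(\alpha,\beta)$ on three rows of vertices $1,\dots,n$; $1'',\dots,n''$; $1',\dots,n'$ joins vertices that lie in a common block of $\alpha$ (lower vertices $x'$ renamed $x''$) or of $\beta$ (upper vertices $x$ renamed $x''$); $\alpha\beta$ is the partition of the outer rows induced by the connected components of $\Gamma(\alpha,\beta)$, and $\Phi(\alpha,\beta)$ is the number of components contained in the middle row. A transversal is a block meeting both rows; $\operatorname{rank}\alpha$ is the number of transversals; $\widehat\alpha$ is obtained from $\alpha$ by splitting each transversal into its upper and lower parts. Green's relations on $\mathcal P_n$ are $\alpha\mathrel{\mathscr R}\beta\iff\alpha\mathcal P_n=\beta\mathcal P_n$, $\alpha\mathrel{\mathscr L}\beta\iff\mathcal P_n\alpha=\mathcal P_n\beta$, $\mathscr H=\mathscr R\cap\mathscr L$. If $\alpha\mathrel{\mathscr H}\beta$ have rank $q$, the transversals of $\alpha$ are $A_t\cup B_t'$ $(1\le t\le q)$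 and those of $\beta$ are $A_t\cup B_{t\pi}'$ for some $\pi\in\mathcal S_q$; we write $\partial(\alpha,\beta)=\pi$ (well defined up to conjugacy). The $d$-twisted partition monoid is $\mathcal P^\Phi_{n,d}=(\{0,\dots,d\}\times\mathcal P_n)\cup\{\mathbf 0\}$, where $(i,\alpha)(j,\beta)=(i+j+\Phi(\alpha,\beta),\alpha\beta)$ if $i+j+\Phi(\alpha,\beta)\le d$, and all other products are $\mathbf 0$. **fC-matrices.** An fC-matrix is a matrix $M=(M_{qi})_{0\le q\le n,\,0\le i\le d}$ with entries from $\{\Delta,\mu^\uparrow,\mu^\downarrow,\mu,R\}$ and the $N$-symbols ($\{\mathrm{id}_q\}\ne N\trianglelefteq\mathcal S_q$, $2\le q\le n$), such that rows $0,1$ are of one of the types fRT1–fRT4, each row $q\ge2$ is of type fRT5, and (V1), (V2) hold. Here $\zeta\in\{\mu,\mu^\uparrow,\mu^\downarrow,\Delta\}$ if $n\ge 2$, and $\zeta=\Delta$ if $n=1$. * fRT1 ($0\le k\le d+1$): both rows are $\Delta$ in columns $<k$ and $R$ in columns $\ge k$. * fRT2 ($0\le i<k\le d$): row $0$ is $\Delta$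 in columns $<i$, $\mu$ in columns $i,\dots,k-1$, $R$ in columns $\ge k$; row $1$ is $\Delta$ in columns $<i$, $\zeta$ in column $i$, $\mu$ in columns $i+1,\dots,k$, $R$ in columns $\ge k+1$. * fRT3 ($0\le k<l\le d+1$): row $0$ is $\Delta$ in columns $<k$, $R$ in columns $\ge k$; row $1$ is $\Delta$ in columns $<l-1$, $\zeta$ in column $l-1$, $R$ in columns $\ge l$. * fRT4 ($0<k<l-1\le d$): row $0$ is $\Delta$ in columns $<k-1$, $\mu$ in column $k-1$, $R$ in columns $\ge k$; row $1$ is $\Delta$ in columns $<l-1$, $\mu$ in column $l-1$, $R$ in columns $\ge l$. * fRT5 ($q\ge2$, $0\le i\le k\le d+1$): row $q$ is $\Delta$ in columns $<i$, then $N_i,\dots,N_{k-1}$ in columns $i,\dots,k-1$, then $R$ in columns $\ge k$, where $\{\mathrm{id}_q\}\ne N_i\le\dots\le N_{k-1}$ are normal subgroups of $\mathcal S_q$. * (V1) An $N$-symbol is never immediately above $\Delta$, $\mu^\uparrow$, $\mu^\downarrow$ or an $N$-symbol. (V2) Every $R$ in a row $q\ge2$ is directly above an $R$ in row $q-1$.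 (Row $q$ is above row $q-1$.) Let $\min_q(M)$ be the first column containing $R$ in row $q$ ($d+1$ if there is none). For $M$ of type fRT2 or fRT4 let $\mu\mathrm{in}_0(M)$ be the first column containing $\mu$ in row $0$, and let $\mu\mathrm{in}_1(M)$ be $\mu\mathrm{in}_0(M)+1$ for type fRT2 and $\min_1(M)-1$ for type fRT4. Let $\leq_C$ be the partial order on entries with bottom $\Delta$ and top $R$, $\mu^\uparrow,\mu^\downarrow<\mu$, $N\le_C N'$ for $N\le N'\trianglelefteq\mathcal S_q$ with the same $q$, and no other relations; write $M^1\leq_C M^2$ if this holds entrywise. **The relation $\mathsf{cg}(M)$.** $\mathsf{cg}(M)$ consists of $(\mathbf 0,\mathbf 0)$, the pairs $((i,\alpha),\mathbf 0)$, $(\mathbf 0,(i,\alpha))$ with $M_{qi}=R$, and the pairs $((i,\alpha),(j,\beta))$ such that, with $q=\operatorname{rank}\alpha$, $r=\operatorname{rank}\beta$, one of these holds: $M_{qi}=M_{rj}=\Delta$, $i=j$, $\alpha=\beta$; $M_{qi}=M_{rj}=R$; $M_{qi}=M_{rj}=N$, $i=j$, $\alpha\mathrel{\mathscr H}\beta$,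 $\partial(\alpha,\beta)\in N$; $M_{qi}=M_{rj}=\mu^\downarrow$, $\widehat\alpha=\widehat\beta$, $\alpha\mathrel{\mathscr L}\beta$; $M_{qi}=M_{rj}=\mu^\uparrow$, $\widehat\alpha=\widehat\beta$, $\alpha\mathrel{\mathscr R}\beta$; $M_{qi}=M_{rj}=\mu$, $\widehat\alpha=\widehat\beta$, and either $(q,i)=(r,j)$ or $i-j=\min_q(M)-\min_r(M)$. **Theorem.** Let $n\geq1$ and $d\geq0$, and let $M^1$ and $M^2$ be any two fC-matrices for $\mathcal P^\Phi_{n,d}$. Then $\mathsf{cg}(M^1)\subseteq\mathsf{cg}(M^2)$ if and only if both of the following hold: 1. $M^1\leq_C M^2$; 2. if $M^1$ has type fRT2 or fRT4, then at least one of the following holds: * $\min_0(M^2)\leq\mu\mathrm{in}_0(M^1)$ and $\min_1(M^2)\leq\mu\mathrm{in}_1(M^1)$, or * $M^2$ also has type fRT2 or fRT4, and $\min_1(M^2)-\min_0(M^2)=\min_1(M^1)-\min_0(M^1)$. -/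

import Mathlib

namespace TwistedPartition

/-- The elements of the partition monoid: set partitions of `{1,…,n} ∪ {1',…,n'}`.  The upper vertex
`x` is `Sum.inl x` and the lower vertex `x'` is `Sum.inr x`. -/
abbrev PartMon (n : ℕ) : Type := Setoid (Fin n ⊕ Fin n)

/-- The vertices of a product graph: upper row, middle row, lower row. -/
abbrev Vert (n : ℕ) : Type := Fin n ⊕ (Fin n ⊕ Fin n)

/-- The vertices of the first factor: its lower row becomes the middle row. -/
def upperEmb {n : ℕ} : Fin n ⊕ Fin n → Vert n
  | Sum.inl x => Sum.inl x
  | Sum.inr x => Sum.inr (Sum.inl x)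

/-- The vertices of the second factor: its upper row becomes the middle row. -/
def lowerEmb {n : ℕ} : Fin n ⊕ Fin n → Vert n
  | Sum.inl x => Sum.inr (Sum.inl x)
  | Sum.inr x => Sum.inr (Sum.inr x)

/-- The vertices of the product: the upper and the lower row. -/
def outerEmb {n : ℕ} : Fin n ⊕ Fin n → Vert n
  | Sum.inl x => Sum.inl x
  | Sum.inr x => Sum.inr (Sum.inr x)

/-- Adjacency in the product graph `Γ(α, β)`. -/
def prodAdj {n : ℕ} (α β : PartMon n) (u v : Vert n) : Prop :=
  (∃ x y, α x y ∧ u = upperEmb x ∧ v = upperEmb y) ∨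
  (∃ x y, β x y ∧ u = lowerEmb x ∧ v = lowerEmb y)

/-- The connected components of the product graph `Γ(α, β)`. -/
def prodComp {n : ℕ} (α β : PartMon n) : Setoid (Vert n) :=
  Relation.EqvGen.setoid (prodAdj α β)

/-- The product `αβ`: outer vertices are in the same block iff they are in the same connected
component of the product graph. -/
instance {n : ℕ} : Mul (PartMon n) where
  mul α β := Setoid.comap outerEmb (prodComp α β)

/-- `Φ(α, β)`: the number of floating components, i.e. the components of the product graph all of
whose vertices are in the middle row. -/
noncomputable def floating {n : ℕ} (α β : PartMon n) : ℕ :=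
  {C ∈ (prodComp α β).classes | ∀ v ∈ C, ∃ x : Fin n, v = Sum.inr (Sum.inl x)}.ncard

/-- The transversals of `α`: the blocks with both upper and lower vertices. -/
def transversals {n : ℕ} (α : PartMon n) : Set (Set (Fin n ⊕ Fin n)) :=
  {B ∈ α.classes | (∃ x, Sum.inl x ∈ B) ∧ (∃ y, Sum.inr y ∈ B)}

/-- The rank of `α`: its number of transversals. -/
noncomputable def rank {n : ℕ} (α : PartMon n) : ℕ := (transversals α).ncard

theorem rank_lt {n : ℕ} (α : PartMon n) : rank α < n + 1 := by
  classical
  have h : ∀ B : transversals α, ∃ x, Sum.inl x ∈ B.1 := fun B => B.2.2.1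
  choose f hf using h
  have hinj : Function.Injective f := by
    intro B C hBC
    apply Subtype.ext
    refine Setoid.eq_of_mem_classes B.2.1 (hf B) C.2.1 ?_
    rw [hBC]
    exact hf C
  have hcard := Nat.card_le_card_of_injective f hinj
  rw [Nat.card_fin] at hcard
  exact Nat.lt_succ_of_le hcard

/-- The rank of `α`, as the index of a row of a matrix with rows `0, …, n`. -/
noncomputable def row {n : ℕ} (α : PartMon n) : Fin (n + 1) := ⟨rank α, rank_lt α⟩

/-- `α̂`: every transversal of `α` is broken into its upper part and its lower part. -/
abbrev hat {n : ℕ} (α : PartMon n) : PartMon n := α ⊓ Setoid.ker Sum.isLeft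

/-- Green's relation `ℛ` on the partition monoid: equality of principal right ideals. -/
def GreenR {n : ℕ} (α β : PartMon n) : Prop :=
  Set.range (fun γ : PartMon n => α * γ) = Set.range (fun γ : PartMon n => β * γ)

/-- Green's relation `ℒ` on the partition monoid: equality of principal left ideals. -/
def GreenL {n : ℕ} (α β : PartMon n) : Prop :=
  Set.range (fun γ : PartMon n => γ * α) = Set.range (fun γ : PartMon n => γ * β)

/-- Green's relation `ℋ`. -/
def GreenH {n : ℕ} (α β : PartMon n) : Prop := GreenR α β ∧ GreenL α β

/-- `π` is a permutational difference of `α` and `β`: for some listing (without repetition)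
`A₁ ∪ B₁', …, A_q ∪ B_q'` of the transversals of `α`, the transversals of `β` are the
`A_i ∪ B_{iπ}'`.  For `ℋ`-related `α` and `β` of rank `q` such `π` exist, and they form a conjugacy
class of the symmetric group, so membership of one or of all of them in a normal subgroup is
the same. -/
def IsPermDiff {n q : ℕ} (α β : PartMon n) (π : Equiv.Perm (Fin q)) : Prop :=
  ∃ A B : Fin q → Set (Fin n), Function.Injective A ∧
    transversals α = Set.range (fun t => Sum.inl '' A t ∪ Sum.inr '' B t) ∧
    transversals β = Set.range (fun t => Sum.inl '' A t ∪ Sum.inr '' B (π t))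

/-- The underlying set `({0,…,d} × 𝒫ₙ) ∪ {0}` of the `d`-twisted partition monoid. -/
inductive Twisted (n d : ℕ) : Type
  | zero : Twisted n d
  | mk (i : Fin (d + 1)) (α : PartMon n) : Twisted n d

/-- The product of the `d`-twisted partition monoid. -/
noncomputable instance {n d : ℕ} : Mul (Twisted n d) where
  mul
    | Twisted.mk i α, Twisted.mk j β =>
      if h : (i : ℕ) + j + floating α β < d + 1 then
        Twisted.mk ⟨(i : ℕ) + j + floating α β, h⟩ (α * β)
      else Twisted.zero
    | _, _ => Twisted.zero

/-- Matrix entries: `Δ`, `μ↑`, `μ↓`, `μ`, `R`, and the `N`-symbols; the `N`-symbol of a subgroup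
`N ≤ S_q` records `q`.  (That `q ≥ 2` and that `N` is normal and nontrivial is part of the definition
of a finitary C-matrix.) -/
inductive Entry : Type
  | delta : Entry
  | muUp : Entry
  | muDown : Entry
  | mu : Entry
  | R : Entry
  | sub (q : ℕ) (N : Subgroup (Equiv.Perm (Fin q))) : Entry

/-- The entry is an `N`-symbol. -/
def Entry.IsN (e : Entry) : Prop :=
  ∃ (q : ℕ) (N : Subgroup (Equiv.Perm (Fin q))), e = Entry.sub q N

/-- The order `≤_C` on matrix entries: `Δ` is the bottom, `R` is the top, `μ↑, μ↓ < μ`, and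
`N`-symbols for the same `q` are ordered by inclusion. -/
inductive Entry.le : Entry → Entry → Prop
  | refl (e : Entry) : Entry.le e e
  | bot (e : Entry) : Entry.le Entry.delta e
  | top (e : Entry) : Entry.le e Entry.R
  | up : Entry.le Entry.muUp Entry.mu
  | down : Entry.le Entry.muDown Entry.mu
  | sub {q : ℕ} {N N' : Subgroup (Equiv.Perm (Fin q))} (h : N ≤ N') :
      Entry.le (Entry.sub q N) (Entry.sub q N')

/-- Matrices with rows `0, …, n` and columns `0, …, d`. -/
abbrev Mat (n d : ℕ) : Type := Fin (n + 1) → Fin (d + 1) → Entry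

/-- The order `≤_C` on matrices, entrywise. -/
def LeC {n d : ℕ} (M₁ M₂ : Mat n d) : Prop := ∀ q i, Entry.le (M₁ q i) (M₂ q i)

/-- The symbols that may stand in the place `ζ` of row `1`.  For `n = 1` there is only one partition
of rank `1`, the symbols `μ↑`, `μ↓` and an unmatched `μ` in that place would all mean the same as `Δ`,
and only `Δ` is used. -/
def IsZeta (n : ℕ) (ζ : Entry) : Prop :=
  (ζ = Entry.mu ∨ ζ = Entry.muUp ∨ ζ = Entry.muDown ∨ ζ = Entry.delta) ∧
    (n = 1 → ζ = Entry.delta)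

/-- Rows `0` and `1` of the first type: both are `Δ … Δ R … R`, with `R` from column `k` on. -/
def IsFRT1 {n d : ℕ} (M : Mat n d) : Prop :=
  ∃ k : ℕ, k ≤ d + 1 ∧ ∀ c : Fin (d + 1),
    M 0 c = (if (c : ℕ) < k then Entry.delta else Entry.R) ∧
    M 1 c = (if (c : ℕ) < k then Entry.delta else Entry.R)

/-- Rows `0` and `1` of the second type.  Row `0`: `Δ` before column `i`, `μ` in columns
`i, …, k - 1`, then `R`.  Row `1`: `Δ` before column `i`, `ζ` in column `i`, `μ` in columns
`i + 1, …, k`, then `R`. -/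
def IsFRT2 {n d : ℕ} (M : Mat n d) : Prop :=
  ∃ (i k : ℕ) (ζ : Entry), i < k ∧ k ≤ d ∧ IsZeta n ζ ∧ ∀ c : Fin (d + 1),
    M 0 c = (if (c : ℕ) < i then Entry.delta else if (c : ℕ) < k then Entry.mu else Entry.R) ∧
    M 1 c = (if (c : ℕ) < i then Entry.delta else if (c : ℕ) = i then ζ
      else if (c : ℕ) ≤ k then Entry.mu else Entry.R)

/-- Rows `0` and `1` of the third type.  Row `0`: `Δ` before column `k`, then `R`.  Row `1`: `Δ`
before column `l - 1`, `ζ` in column `l - 1`, then `R`. -/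
def IsFRT3 {n d : ℕ} (M : Mat n d) : Prop :=
  ∃ (k l : ℕ) (ζ : Entry), k < l ∧ l ≤ d + 1 ∧ IsZeta n ζ ∧ ∀ c : Fin (d + 1),
    M 0 c = (if (c : ℕ) < k then Entry.delta else Entry.R) ∧
    M 1 c = (if (c : ℕ) + 1 < l then Entry.delta else if (c : ℕ) + 1 = l then ζ else Entry.R)

/-- Rows `0` and `1` of the fourth type (with `0 < k < l - 1 ≤ d`).  Row `0`: `Δ` before column
`k - 1`, `μ` in column `k - 1`, then `R`.  Row `1`: `Δ` before column `l - 1`, `μ` in column `l - 1`,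
then `R`. -/
def IsFRT4 {n d : ℕ} (M : Mat n d) : Prop :=
  ∃ k l : ℕ, 0 < k ∧ k + 1 < l ∧ l ≤ d + 1 ∧ ∀ c : Fin (d + 1),
    M 0 c = (if (c : ℕ) + 1 < k then Entry.delta else if (c : ℕ) + 1 = k then Entry.mu
      else Entry.R) ∧
    M 1 c = (if (c : ℕ) + 1 < l then Entry.delta else if (c : ℕ) + 1 = l then Entry.mu
      else Entry.R)

/-- The fifth type, for a row `q ≥ 2`: `Δ` before column `i`, then a chain `N_i ≤ … ≤ N_{k-1}` of
nontrivial normal subgroups of `S_q`, then `R` from column `k` on. -/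
def IsFRT5 {n d : ℕ} (M : Mat n d) (q : Fin (n + 1)) : Prop :=
  ∃ (i k : ℕ) (N : ℕ → Subgroup (Equiv.Perm (Fin (q : ℕ)))), i ≤ k ∧ k ≤ d + 1 ∧
    (∀ c, i ≤ c → c < k → (N c).Normal ∧ N c ≠ ⊥) ∧
    (∀ c, i ≤ c → c + 1 < k → N c ≤ N (c + 1)) ∧
    ∀ c : Fin (d + 1), M q c =
      (if (c : ℕ) < i then Entry.delta else if (c : ℕ) < k then Entry.sub (q : ℕ) (N c)
        else Entry.R)

/-- Finitary C-matrices (fC-matrices), for `n ≥ 1`. -/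
structure IsFC {n d : ℕ} (M : Mat n d) : Prop where
  /-- Rows `0` and `1` are of one of the first four types. -/
  rows01 : IsFRT1 M ∨ IsFRT2 M ∨ IsFRT3 M ∨ IsFRT4 M
  /-- Every other row is of the fifth type. -/
  rows : ∀ q : Fin (n + 1), 2 ≤ (q : ℕ) → IsFRT5 M q
  /-- An `N`-symbol is not immediately above `Δ`, `μ↑`, `μ↓` or an `N`-symbol. -/
  vert1 : ∀ p q : Fin (n + 1), (q : ℕ) = p + 1 → ∀ c, (M q c).IsN →
    M p c ≠ Entry.delta ∧ M p c ≠ Entry.muUp ∧ M p c ≠ Entry.muDown ∧ ¬ (M p c).IsN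
  /-- Every `R` in a row `q ≥ 2` is directly above an `R`. -/
  vert2 : ∀ p q : Fin (n + 1), (q : ℕ) = p + 1 → 2 ≤ (q : ℕ) → ∀ c, M q c = Entry.R →
    M p c = Entry.R

/-- `min_q(M)`: the first column with an `R` in row `q`, and `d + 1` if there is none. -/
noncomputable def minR {n d : ℕ} (M : Mat n d) (q : Fin (n + 1)) : ℕ :=
  sInf ({i : ℕ | ∃ c : Fin (d + 1), (c : ℕ) = i ∧ M q c = Entry.R} ∪ {d + 1})

/-- `μin₀(M)`, for `M` of the second or fourth type: the position of the first `μ` in row `0`. -/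
noncomputable def muIn0 {n d : ℕ} (M : Mat n d) : ℕ :=
  sInf {i : ℕ | ∃ c : Fin (d + 1), (c : ℕ) = i ∧ M 0 c = Entry.mu}

open Classical in
/-- `μin₁(M)`, for `M` of the second or fourth type: the position of the `μ` in row `1` that matches
the first `μ` of row `0`.  It is `i + 1` in the second type and `l - 1` in the fourth. -/
noncomputable def muIn1 {n d : ℕ} (M : Mat n d) : ℕ :=
  if IsFRT2 M then muIn0 M + 1 else minR M 1 - 1

/-- The relation on the `d`-twisted partition monoid that is associated with a matrix. -/
inductive CgRel {n d : ℕ} (M : Mat n d) : Twisted n d → Twisted n d → Prop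
  | fC1 {i j : Fin (d + 1)} {α β : PartMon n}
      (hα : M (row α) i = Entry.delta) (hβ : M (row β) j = Entry.delta)
      (hij : i = j) (h : α = β) : CgRel M (Twisted.mk i α) (Twisted.mk j β)
  | fC2 {i j : Fin (d + 1)} {α β : PartMon n}
      (hα : M (row α) i = Entry.R) (hβ : M (row β) j = Entry.R) :
      CgRel M (Twisted.mk i α) (Twisted.mk j β)
  | fC3 {i j : Fin (d + 1)} {α β : PartMon n} {q : ℕ} {N : Subgroup (Equiv.Perm (Fin q))}
      (hα : M (row α) i = Entry.sub q N) (hβ : M (row β) j = Entry.sub q N)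
      (hij : i = j) (h : GreenH α β) (hN : ∃ π ∈ N, IsPermDiff α β π) :
      CgRel M (Twisted.mk i α) (Twisted.mk j β)
  | fC4 {i j : Fin (d + 1)} {α β : PartMon n}
      (hα : M (row α) i = Entry.muDown) (hβ : M (row β) j = Entry.muDown)
      (hhat : hat α = hat β) (h : GreenL α β) : CgRel M (Twisted.mk i α) (Twisted.mk j β)
  | fC5 {i j : Fin (d + 1)} {α β : PartMon n}
      (hα : M (row α) i = Entry.muUp) (hβ : M (row β) j = Entry.muUp)
      (hhat : hat α = hat β) (h : GreenR α β) : CgRel M (Twisted.mk i α) (Twisted.mk j β)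
  | fC6 {i j : Fin (d + 1)} {α β : PartMon n}
      (hα : M (row α) i = Entry.mu) (hβ : M (row β) j = Entry.mu)
      (hhat : hat α = hat β)
      (h : (row α = row β ∧ i = j) ∨
        ((i : ℕ) : ℤ) - ((j : ℕ) : ℤ) = (minR M (row α) : ℤ) - (minR M (row β) : ℤ)) :
      CgRel M (Twisted.mk i α) (Twisted.mk j β)
  | fC7_left {i : Fin (d + 1)} {α : PartMon n} (hα : M (row α) i = Entry.R) :
      CgRel M (Twisted.mk i α) Twisted.zero
  | fC7_right {i : Fin (d + 1)} {α : PartMon n} (hα : M (row α) i = Entry.R) :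
      CgRel M Twisted.zero (Twisted.mk i α)
  | fC8 : CgRel M Twisted.zero Twisted.zero

/-- `cg(M)`, as a set of pairs. -/
def cg {n d : ℕ} (M : Mat n d) : Set (Twisted n d × Twisted n d) :=
  {p | CgRel M p.1 p.2}

end TwistedPartition

namespace TwistedPartition

/-! Both directions rest on what each symbol contributes to the relation. Almost every clause of
`CgRel` compares elements of one row and one column, where the order on entries mirrors inclusion of
relations. The exception is `mu` in rows `0` and `1`: it also relates elements of rank `0` to
elements of rank `1`, in columns whose difference is prescribed by the matrix. The second condition
of the theorem governs exactly these cross-row pairs, which `Linked` records by their columns alone.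

From inclusion to order, each symbol is detected by test pairs. `R` is detected by a pair with zero
(`R_of_subset`), and a subgroup by the group elements `ofPerm 1` and `ofPerm π`
(`le_of_subset_of_sub`). For `n ≥ 2` the `mu` symbols of row `1` are detected by rank one partial
permutations that are `ℛ`-related only, `ℒ`-related only, or neither (`le_row_one_of_subset`). Row
`0`, and row `1` for `n = 1`, have no distinct elements with the same `hat`, so there `mu` is
detected by cross-row pairs (`Linked.of_subset`). The first matched pair of columns also yields the
second condition (`matching_of_subset`).

Conversely, raising an entry preserves pairs within a row and column, and `Linked.of_le` handles
cross-row pairs: either the first matched columns already lie in the `R` regions of the larger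
matrix, and hence so do all later ones, or the offsets agree and both entries are `mu` or both are
`R`. -/

/-! ### Relabelling the middle row -/

/-- Applying a permutation to the middle row of a product graph. -/
def midMap {n : ℕ} (τ : Equiv.Perm (Fin n)) : Vert n → Vert n :=
  Sum.map id (Sum.map τ id)

/-- Relabelling the upper row of a partition. -/
def relabelUp {n : ℕ} (τ : Equiv.Perm (Fin n)) (α : PartMon n) : PartMon n :=
  Setoid.comap (Sum.map τ id) α

/-- Relabelling the lower row of a partition. -/
def relabelDown {n : ℕ} (τ : Equiv.Perm (Fin n)) (α : PartMon n) : PartMon n :=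
  Setoid.comap (Sum.map id τ) α

theorem relabelUp_rel {n : ℕ} {τ : Equiv.Perm (Fin n)} {α : PartMon n}
    {x y : Fin n ⊕ Fin n} :
    relabelUp τ α x y ↔ α (Sum.map τ id x) (Sum.map τ id y) := Iff.rfl

theorem relabelUp_symm {n : ℕ} (τ : Equiv.Perm (Fin n)) (α : PartMon n) :
    relabelUp τ⁻¹ (relabelUp τ α) = α := by
  ext x y
  rw [relabelUp_rel, relabelUp_rel]
  rcases x with x | x <;> rcases y with y | y <;> simp

theorem relabelDown_rel {n : ℕ} {τ : Equiv.Perm (Fin n)} {α : PartMon n}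
    {x y : Fin n ⊕ Fin n} :
    relabelDown τ α x y ↔ α (Sum.map id τ x) (Sum.map id τ y) := Iff.rfl

theorem relabelDown_symm {n : ℕ} (τ : Equiv.Perm (Fin n)) (α : PartMon n) :
    relabelDown τ⁻¹ (relabelDown τ α) = α := by
  ext x y
  rw [relabelDown_rel, relabelDown_rel]
  rcases x with x | x <;> rcases y with y | y <;> simp

theorem mul_rel {n : ℕ} {α β : PartMon n} {x y : Fin n ⊕ Fin n} :
    (α * β) x y ↔ Relation.EqvGen (prodAdj α β) (outerEmb x) (outerEmb y) := Iff.rfl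

theorem eqvGen_midMap {n : ℕ} (τ : Equiv.Perm (Fin n)) (α β : PartMon n) {u v : Vert n}
    (h : Relation.EqvGen (prodAdj (relabelDown τ α) (relabelUp τ β)) u v) :
    Relation.EqvGen (prodAdj α β) (midMap τ u) (midMap τ v) := by
  induction h with
  | rel u v h =>
    refine Relation.EqvGen.rel _ _ ?_
    rcases h with ⟨x, y, h, rfl, rfl⟩ | ⟨x, y, h, rfl, rfl⟩
    · refine Or.inl ⟨Sum.map id τ x, Sum.map id τ y, h, ?_, ?_⟩
      · rcases x with x | x <;> rfl
      · rcases y with x | x <;> rfl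
    · refine Or.inr ⟨Sum.map τ id x, Sum.map τ id y, h, ?_, ?_⟩
      · rcases x with x | x <;> rfl
      · rcases y with x | x <;> rfl
  | refl u => exact Relation.EqvGen.refl _
  | symm u v _ ih => exact ih.symm
  | trans u v w _ _ ih₁ ih₂ => exact ih₁.trans _ _ _ ih₂

/-- `midMap τ` carries one product graph onto the other and fixes the outer rows. Hence a one-sided
factor can absorb a permutation, which is what produces `ℒ`- and `ℛ`-related elements below. -/
theorem relabel_mul {n : ℕ} (τ : Equiv.Perm (Fin n)) (α β : PartMon n) :
    relabelDown τ α * relabelUp τ β = α * β := by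
  have hout : ∀ (τ : Equiv.Perm (Fin n)) x, midMap τ (outerEmb x) = outerEmb x := by
    rintro τ (x | x) <;> rfl
  ext x y
  refine Iff.trans mul_rel (Iff.trans ?_ mul_rel.symm)
  constructor
  · intro h
    simpa only [hout] using eqvGen_midMap τ α β h
  · intro h
    have := eqvGen_midMap τ⁻¹ (relabelDown τ α) (relabelUp τ β) (u := outerEmb x)
      (v := outerEmb y) (by rwa [relabelUp_symm, relabelDown_symm])
    simpa only [hout] using this

theorem greenL_relabelUp {n : ℕ} (τ : Equiv.Perm (Fin n)) (α : PartMon n) :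
    GreenL α (relabelUp τ α) := by
  apply Set.Subset.antisymm
  · rintro _ ⟨γ, rfl⟩
    exact ⟨relabelDown τ γ, relabel_mul τ γ α⟩
  · rintro _ ⟨γ, rfl⟩
    refine ⟨relabelDown τ⁻¹ γ, ?_⟩
    have := relabel_mul τ⁻¹ γ (relabelUp τ α)
    rwa [relabelUp_symm] at this

theorem greenR_relabelDown {n : ℕ} (τ : Equiv.Perm (Fin n)) (α : PartMon n) :
    GreenR α (relabelDown τ α) := by
  apply Set.Subset.antisymm
  · rintro _ ⟨γ, rfl⟩
    exact ⟨relabelUp τ γ, relabel_mul τ α γ⟩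
  · rintro _ ⟨γ, rfl⟩
    refine ⟨relabelUp τ⁻¹ γ, ?_⟩
    have := relabel_mul τ⁻¹ (relabelDown τ α) γ
    rwa [relabelDown_symm] at this

/-! ### Green's relations preserve the vertices of transversals -/

/-- If the `β`-block of `y'` had no upper vertex, it would avoid the middle row, so no edge of `γ`
would touch it. It would then be a whole component of the product graph, out of reach of the top
row. -/
theorem exists_upper_of_mul {n : ℕ} {γ β : PartMon n} {x y : Fin n}
    (h : (γ * β) (Sum.inl x) (Sum.inr y)) : ∃ x', β (Sum.inl x') (Sum.inr y) := by
  by_contra hno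
  push Not at hno
  have key : ∀ u v, Relation.EqvGen (prodAdj γ β) u v →
      ((∃ w, u = lowerEmb w ∧ β w (Sum.inr y)) ↔ (∃ w, v = lowerEmb w ∧ β w (Sum.inr y))) := by
    intro u v h
    induction h with
    | rel u v h =>
      rcases h with ⟨a, b, h, rfl, rfl⟩ | ⟨a, b, h, rfl, rfl⟩
      · have hn : ∀ a, ¬ ∃ w, upperEmb a = lowerEmb w ∧ β w (Sum.inr y) := by
          rintro a ⟨w | w, hw, hβ⟩
          · exact hno _ hβ
          · rcases a with a | a <;> simp [upperEmb, lowerEmb] at hw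
        simp only [hn]
      · have hinj : ∀ a b : Fin n ⊕ Fin n, lowerEmb a = lowerEmb b → a = b := by
          rintro (a | a) (b | b) hab <;> simp_all [lowerEmb]
        constructor
        · rintro ⟨w, hw, hβ⟩
          rw [← hinj _ _ hw] at hβ
          exact ⟨b, rfl, β.trans (β.symm h) hβ⟩
        · rintro ⟨w, hw, hβ⟩
          rw [← hinj _ _ hw] at hβ
          exact ⟨a, rfl, β.trans h hβ⟩
    | refl u => exact Iff.rfl
    | symm u v _ ih => exact ih.symm
    | trans u v w _ _ ih₁ ih₂ => exact ih₁.trans ih₂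
  obtain ⟨w | w, hw, -⟩ := (key _ _ (mul_rel.1 h)).2 ⟨Sum.inr y, rfl, β.refl _⟩ <;>
    simp [outerEmb, lowerEmb] at hw

theorem exists_lower_of_mul {n : ℕ} {γ β : PartMon n} {x y : Fin n}
    (h : (β * γ) (Sum.inl x) (Sum.inr y)) : ∃ y', β (Sum.inl x) (Sum.inr y') := by
  by_contra hno
  push Not at hno
  have key : ∀ u v, Relation.EqvGen (prodAdj β γ) u v →
      ((∃ w, u = upperEmb w ∧ β (Sum.inl x) w) ↔ (∃ w, v = upperEmb w ∧ β (Sum.inl x) w)) := by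
    intro u v h
    induction h with
    | rel u v h =>
      rcases h with ⟨a, b, h, rfl, rfl⟩ | ⟨a, b, h, rfl, rfl⟩
      · have hinj : ∀ a b : Fin n ⊕ Fin n, upperEmb a = upperEmb b → a = b := by
          rintro (a | a) (b | b) hab <;> simp_all [upperEmb]
        constructor
        · rintro ⟨w, hw, hβ⟩
          rw [← hinj _ _ hw] at hβ
          exact ⟨b, rfl, β.trans hβ h⟩
        · rintro ⟨w, hw, hβ⟩
          rw [← hinj _ _ hw] at hβ
          exact ⟨a, rfl, β.trans hβ (β.symm h)⟩
      · have hn : ∀ a, ¬ ∃ w, lowerEmb a = upperEmb w ∧ β (Sum.inl x) w := by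
          rintro a ⟨w | w, hw, hβ⟩
          · rcases a with a | a <;> simp [upperEmb, lowerEmb] at hw
          · exact hno _ hβ
        simp only [hn]
    | refl u => exact Iff.rfl
    | symm u v _ ih => exact ih.symm
    | trans u v w _ _ ih₁ ih₂ => exact ih₁.trans ih₂
  obtain ⟨w | w, hw, -⟩ := (key _ _ (mul_rel.1 h)).1 ⟨Sum.inl x, rfl, β.refl _⟩ <;>
    simp [outerEmb, upperEmb] at hw

theorem GreenL.exists_upper {n : ℕ} {α β : PartMon n} (h : GreenL α β) {x y : Fin n}
    (hxy : α (Sum.inl x) (Sum.inr y)) : ∃ x', β (Sum.inl x') (Sum.inr y) := by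
  -- The one-block partition `⊤` serves as a left factor that keeps `y'` in a transversal, giving an
  -- element of the left ideal of `α` that must also be a left multiple of `β`.
  have htop : (⊤ * α : PartMon n) (Sum.inl x) (Sum.inr y) := by
    refine mul_rel.2 ?_
    refine Relation.EqvGen.trans _ (Sum.inr (Sum.inl x)) _ (Relation.EqvGen.rel _ _ (Or.inl ?_))
      (Relation.EqvGen.rel _ _ (Or.inr ⟨_, _, hxy, rfl, rfl⟩))
    exact ⟨Sum.inl x, Sum.inr x, trivial, rfl, rfl⟩
  have hmem : (⊤ * α : PartMon n) ∈ Set.range (fun γ : PartMon n => γ * β) := by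
    rw [← h]
    exact ⟨⊤, rfl⟩
  obtain ⟨γ, hγ⟩ := hmem
  rw [← hγ] at htop
  exact exists_upper_of_mul htop

theorem GreenR.exists_lower {n : ℕ} {α β : PartMon n} (h : GreenR α β) {x y : Fin n}
    (hxy : α (Sum.inl x) (Sum.inr y)) : ∃ y', β (Sum.inl x) (Sum.inr y') := by
  have htop : (α * ⊤ : PartMon n) (Sum.inl x) (Sum.inr y) := by
    refine mul_rel.2 ?_
    refine Relation.EqvGen.trans _ (Sum.inr (Sum.inl y)) _
      (Relation.EqvGen.rel _ _ (Or.inl ⟨_, _, hxy, rfl, rfl⟩))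
      (Relation.EqvGen.rel _ _ (Or.inr ?_))
    exact ⟨Sum.inl y, Sum.inr y, trivial, rfl, rfl⟩
  have hmem : (α * ⊤ : PartMon n) ∈ Set.range (fun γ : PartMon n => β * γ) := by
    rw [← h]
    exact ⟨⊤, rfl⟩
  obtain ⟨γ, hγ⟩ := hmem
  rw [← hγ] at htop
  exact exists_lower_of_mul htop

/-! ### Partial permutations as partitions -/

open Classical in
/-- The partition with blocks `{x, (σ x)'}` for `x ∈ S` and singletons otherwise. -/
noncomputable def partialPerm {n : ℕ} (S : Set (Fin n)) (σ : Equiv.Perm (Fin n)) : PartMon n :=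
  Setoid.ker (Sum.elim Sum.inl
    (fun y => if σ.symm y ∈ S then Sum.inl (σ.symm y) else Sum.inr y) :
      Fin n ⊕ Fin n → Fin n ⊕ Fin n)

open Classical in
theorem partialPerm_rel {n : ℕ} {S : Set (Fin n)} {σ : Equiv.Perm (Fin n)} {x y : Fin n ⊕ Fin n} :
    partialPerm S σ x y ↔
      (Sum.elim Sum.inl (fun y => if σ.symm y ∈ S then Sum.inl (σ.symm y) else Sum.inr y) x :
        Fin n ⊕ Fin n) =
      Sum.elim Sum.inl (fun y => if σ.symm y ∈ S then Sum.inl (σ.symm y) else Sum.inr y) y :=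
  Iff.rfl

theorem partialPerm_inl_inl {n : ℕ} {S : Set (Fin n)} {σ : Equiv.Perm (Fin n)} {x y : Fin n} :
    partialPerm S σ (Sum.inl x) (Sum.inl y) ↔ x = y := by
  rw [partialPerm_rel]
  simp

theorem partialPerm_inl_inr {n : ℕ} {S : Set (Fin n)} {σ : Equiv.Perm (Fin n)} {x y : Fin n} :
    partialPerm S σ (Sum.inl x) (Sum.inr y) ↔ x ∈ S ∧ σ x = y := by
  rw [partialPerm_rel]
  simp only [Sum.elim_inl, Sum.elim_inr]
  constructor
  · intro h
    split_ifs at h with hy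
    obtain rfl := Sum.inl.inj h
    exact ⟨hy, by simp⟩
  · rintro ⟨h, rfl⟩
    simp [h]

theorem partialPerm_inr_inr {n : ℕ} {S : Set (Fin n)} {σ : Equiv.Perm (Fin n)} {x y : Fin n} :
    partialPerm S σ (Sum.inr x) (Sum.inr y) ↔ x = y := by
  rw [partialPerm_rel]
  simp only [Sum.elim_inr]
  constructor
  · intro h
    split_ifs at h
    · simpa using h
    · simpa using h
  · rintro rfl
    rfl

/-- All partial permutations share one `hat`, so the `hat` conditions in the `mu` clauses hold
automatically for test pairs of this form. -/
theorem hat_partialPerm {n : ℕ} (S : Set (Fin n)) (σ : Equiv.Perm (Fin n)) :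
    hat (partialPerm S σ) = ⊥ := by
  ext x y
  rw [Setoid.inf_iff_and, Setoid.ker_def]
  change _ ↔ x = y
  rcases x with x | x <;> rcases y with y | y <;>
    simp [partialPerm_inl_inl, partialPerm_inr_inr]

theorem transversals_partialPerm {n : ℕ} (S : Set (Fin n)) (σ : Equiv.Perm (Fin n)) :
    transversals (partialPerm S σ) =
      (fun x => Sum.inl '' {x} ∪ Sum.inr '' {σ x}) '' S := by
  have hblock : ∀ x ∈ S, {y | partialPerm S σ y (Sum.inl x)} =
      Sum.inl '' {x} ∪ Sum.inr '' {σ x} := by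
    intro x hx
    ext y
    rcases y with y | y
    · simp [partialPerm_inl_inl]
    · have := @partialPerm_inl_inr n S σ x y
      rw [Set.mem_ofPred_eq, Setoid.comm', this]
      simp [hx, eq_comm]
  ext B
  constructor
  · rintro ⟨hB, ⟨x, hx⟩, y, hy⟩
    obtain ⟨z, rfl⟩ := hB
    have hrel : partialPerm S σ (Sum.inl x) (Sum.inr y) :=
      (partialPerm S σ).trans hx ((partialPerm S σ).symm hy)
    have hxS := (partialPerm_inl_inr.1 hrel).1
    refine ⟨x, hxS, ?_⟩
    change _ = {y | partialPerm S σ y z}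
    refine (hblock x hxS).symm.trans ?_
    ext w
    exact ⟨fun h => (partialPerm S σ).trans h hx,
      fun h => (partialPerm S σ).trans h ((partialPerm S σ).symm hx)⟩
  · rintro ⟨x, hx, rfl⟩
    refine ⟨?_, ⟨x, by simp⟩, σ x, by simp⟩
    change Sum.inl '' {x} ∪ Sum.inr '' {σ x} ∈ _
    rw [← hblock x hx]
    exact Setoid.mem_classes _ _

theorem pairBlock_inj {n : ℕ} {a b : Fin n} {A B : Set (Fin n)}
    (h : Sum.inl '' A ∪ Sum.inr '' B = (Sum.inl '' {a} ∪ Sum.inr '' {b} : Set (Fin n ⊕ Fin n))) :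
    A = {a} ∧ B = {b} := by
  constructor
  · ext x
    simpa using Set.ext_iff.1 h (Sum.inl x)
  · ext x
    simpa using Set.ext_iff.1 h (Sum.inr x)

theorem rank_partialPerm {n : ℕ} (S : Set (Fin n)) (σ : Equiv.Perm (Fin n)) :
    rank (partialPerm S σ) = S.ncard := by
  rw [rank, transversals_partialPerm, Set.ncard_image_of_injective]
  intro x y h
  simpa using (pairBlock_inj h).1

theorem relabelDown_partialPerm {n : ℕ} (S : Set (Fin n)) (σ τ : Equiv.Perm (Fin n)) :
    relabelDown τ (partialPerm S σ) = partialPerm S (τ⁻¹ * σ) := by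
  have h : ∀ x y, (τ⁻¹ * σ) x = y ↔ σ x = τ y := fun x y => by
    rw [Equiv.Perm.mul_apply, Equiv.Perm.inv_eq_iff_eq, eq_comm, eq_comm]
  ext x y
  rw [relabelDown_rel]
  rcases x with x | x <;> rcases y with y | y <;>
    simp only [Sum.map_inl, Sum.map_inr, id, partialPerm_inl_inl, partialPerm_inl_inr,
      partialPerm_inr_inr, h, EmbeddingLike.apply_eq_iff_eq]
  rw [Setoid.comm', partialPerm_inl_inr, Setoid.comm', partialPerm_inl_inr, h]

theorem relabelUp_partialPerm {n : ℕ} (S : Set (Fin n)) (σ τ : Equiv.Perm (Fin n)) :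
    relabelUp τ (partialPerm S σ) = partialPerm (τ ⁻¹' S) (σ * τ) := by
  ext x y
  rw [relabelUp_rel]
  rcases x with x | x <;> rcases y with y | y <;>
    simp only [Sum.map_inl, Sum.map_inr, id, partialPerm_inl_inl, partialPerm_inl_inr,
      partialPerm_inr_inr, EmbeddingLike.apply_eq_iff_eq, Set.mem_preimage, Equiv.Perm.mul_apply]
  rw [Setoid.comm', partialPerm_inl_inr, Setoid.comm', partialPerm_inl_inr]
  simp

theorem greenR_partialPerm {n : ℕ} (S : Set (Fin n)) (σ τ : Equiv.Perm (Fin n)) :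
    GreenR (partialPerm S σ) (partialPerm S τ) := by
  have := greenR_relabelDown (σ * τ⁻¹) (partialPerm S σ)
  rwa [relabelDown_partialPerm, mul_inv_rev, inv_inv, mul_assoc, inv_mul_cancel, mul_one] at this

theorem greenL_partialPerm {n : ℕ} (S : Set (Fin n)) (σ τ : Equiv.Perm (Fin n)) :
    GreenL (partialPerm S σ) (partialPerm (τ ⁻¹' S) (σ * τ)) := by
  rw [← relabelUp_partialPerm]
  exact greenL_relabelUp τ _

theorem GreenR.mem_of_partialPerm {n : ℕ} {S T : Set (Fin n)} {σ τ : Equiv.Perm (Fin n)}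
    (h : GreenR (partialPerm S σ) (partialPerm T τ)) {x : Fin n} (hx : x ∈ S) : x ∈ T := by
  obtain ⟨y, hy⟩ := h.exists_lower (partialPerm_inl_inr.2 ⟨hx, rfl⟩)
  exact (partialPerm_inl_inr.1 hy).1

theorem GreenL.exists_of_partialPerm {n : ℕ} {S T : Set (Fin n)} {σ τ : Equiv.Perm (Fin n)}
    (h : GreenL (partialPerm S σ) (partialPerm T τ)) {x : Fin n} (hx : x ∈ S) :
    ∃ y ∈ T, τ y = σ x := by
  obtain ⟨y, hy⟩ := h.exists_upper (partialPerm_inl_inr.2 ⟨hx, rfl⟩)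
  exact ⟨y, partialPerm_inl_inr.1 hy⟩

/-! ### The group elements of a given rank -/

/-- The partition of rank `q` with transversals `{t, (π t)'}`, and singletons otherwise. -/
noncomputable def ofPerm {n q : ℕ} (h : q ≤ n) (π : Equiv.Perm (Fin q)) : PartMon n :=
  partialPerm (Set.range (Fin.castLE h)) (π.viaEmbedding (Fin.castLEEmb h))

theorem rank_ofPerm {n q : ℕ} (h : q ≤ n) (π : Equiv.Perm (Fin q)) : rank (ofPerm h π) = q := by
  rw [ofPerm, rank_partialPerm, ← Set.image_univ,
    Set.ncard_image_of_injective _ (Fin.castLE_injective h), Set.ncard_univ, Nat.card_fin]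

theorem transversals_ofPerm {n q : ℕ} (h : q ≤ n) (π : Equiv.Perm (Fin q)) :
    transversals (ofPerm h π) =
      Set.range (fun t => Sum.inl '' {Fin.castLE h t} ∪ Sum.inr '' {Fin.castLE h (π t)}) := by
  rw [ofPerm, transversals_partialPerm, ← Set.range_comp]
  congr 1
  ext1 t
  have := Equiv.Perm.viaEmbedding_apply π (Fin.castLEEmb h) t
  simp only [Fin.coe_castLEEmb] at this
  simp only [Function.comp, this]

theorem greenH_ofPerm {n q : ℕ} (h : q ≤ n) (π ρ : Equiv.Perm (Fin q)) :
    GreenH (ofPerm h π) (ofPerm h ρ) := by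
  refine ⟨greenR_partialPerm _ _ _, ?_⟩
  have hτ : (π⁻¹ * ρ).viaEmbedding (Fin.castLEEmb h) =
      (π.viaEmbedding (Fin.castLEEmb h))⁻¹ * ρ.viaEmbedding (Fin.castLEEmb h) := by
    have := map_mul (Equiv.Perm.viaEmbeddingHom (Fin.castLEEmb h)) π⁻¹ ρ
    rwa [map_inv] at this
  have := greenL_partialPerm (Set.range (Fin.castLE h)) (π.viaEmbedding (Fin.castLEEmb h))
    ((π⁻¹ * ρ).viaEmbedding (Fin.castLEEmb h))
  -- The extended permutation preserves the first `q` points, so relabelling the upper row by it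
  -- does not move the domain.
  have hS : (π⁻¹ * ρ).viaEmbedding (Fin.castLEEmb h) ⁻¹' Set.range (Fin.castLE h) =
      Set.range (Fin.castLE h) := by
    ext x
    constructor
    · rintro ⟨t, ht⟩
      refine ⟨(π⁻¹ * ρ)⁻¹ t, ?_⟩
      apply ((π⁻¹ * ρ).viaEmbedding (Fin.castLEEmb h)).injective
      rw [← ht]
      refine (Equiv.Perm.viaEmbedding_apply _ (Fin.castLEEmb h) _).trans ?_
      simp
    · rintro ⟨t, rfl⟩
      exact ⟨(π⁻¹ * ρ) t, (Equiv.Perm.viaEmbedding_apply _ (Fin.castLEEmb h) t).symm⟩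
  rw [hS, hτ, mul_inv_cancel_left] at this
  exact this

theorem isPermDiff_ofPerm {n q : ℕ} (h : q ≤ n) (π : Equiv.Perm (Fin q)) :
    IsPermDiff (ofPerm h 1) (ofPerm h π) π := by
  refine ⟨fun t => {Fin.castLE h t}, fun t => {Fin.castLE h t}, ?_, transversals_ofPerm h 1,
    transversals_ofPerm h π⟩
  intro s t hst
  simpa using hst

/-- A listing of the transversals of `ofPerm h 1` is a reindexing `f` of the points, and comparing
with those of `ofPerm h π` gives `π ∘ f = f ∘ ρ`. This lets normality pass membership from the
difference `ρ` supplied by `CgRel` to `π` itself. -/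
theorem IsPermDiff.isConj {n q : ℕ} {h : q ≤ n} {π ρ : Equiv.Perm (Fin q)}
    (hd : IsPermDiff (ofPerm h 1) (ofPerm h π) ρ) : IsConj ρ π := by
  obtain ⟨A, B, hA, h₁, h₂⟩ := hd
  rw [transversals_ofPerm] at h₁ h₂
  have hf : ∀ t, ∃ s, A t = {Fin.castLE h s} ∧ B t = {Fin.castLE h s} := by
    intro t
    obtain ⟨s, hs⟩ := h₁.symm.subset ⟨t, rfl⟩
    exact ⟨s, pairBlock_inj hs.symm⟩
  choose f hfA hfB using hf
  have hinj : Function.Injective f := fun s t hst => hA (by rw [hfA, hfA, hst])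
  have hbij := Finite.injective_iff_bijective.1 hinj
  have hcomm : ∀ t, π (f t) = f (ρ t) := by
    intro t
    obtain ⟨s, hs⟩ := h₂.symm.subset ⟨t, rfl⟩
    obtain ⟨h₃, h₄⟩ := pairBlock_inj hs.symm
    rw [hfA] at h₃
    rw [hfB] at h₄
    have h₃ : f t = s := by simpa using h₃
    have h₄ : f (ρ t) = π s := by simpa using h₄
    rw [h₃, h₄]
  rw [isConj_iff]
  refine ⟨Equiv.ofBijective f hbij, ?_⟩
  rw [mul_inv_eq_iff_eq_mul]
  ext1 t
  exact (hcomm t).symm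

theorem ofPerm_injective {n q : ℕ} (h : q ≤ n) : Function.Injective (ofPerm (n := n) h) := by
  intro π ρ hπ
  have hd := congrArg transversals hπ
  rw [transversals_ofPerm, transversals_ofPerm] at hd
  ext1 t
  obtain ⟨s, hs⟩ := hd.subset ⟨t, rfl⟩
  obtain ⟨h₁, h₂⟩ := pairBlock_inj hs
  have h₁ : s = t := by simpa using h₁
  have h₂ : ρ s = π t := by simpa using h₂
  rw [← h₂, h₁]

/-! ### The columns of a matrix -/

theorem minR_eq {n d : ℕ} {M : Mat n d} {q : Fin (n + 1)} {k : ℕ} (hk : k ≤ d + 1)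
    -- For `k = d + 1` the row has no `R`, and the infimum is attained at the adjoined default
    -- value.
    (h : ∀ c : Fin (d + 1), M q c = Entry.R ↔ k ≤ c) : minR M q = k := by
  have hmem : k ∈ {i : ℕ | ∃ c : Fin (d + 1), (c : ℕ) = i ∧ M q c = Entry.R} ∪ {d + 1} := by
    rcases hk.eq_or_lt with rfl | hk
    · exact Or.inr rfl
    · exact Or.inl ⟨⟨k, hk⟩, rfl, (h _).2 le_rfl⟩
  apply le_antisymm
  · exact Nat.sInf_le hmem
  · rcases Nat.sInf_mem ⟨k, hmem⟩ with ⟨c, hc, hR⟩ | hc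
    · rw [minR, ← hc]
      exact (h c).1 hR
    · rw [minR, hc]
      exact hk

/-- The shape of rows `0` and `1` of a matrix of the second or fourth type: row `0` has `μ` exactly in
columns `a, …, k - 1`, and they are matched with the `μ` in columns `a + δ, …, k + δ - 1` of
row `1`. -/
structure MuBlock {n d : ℕ} (M : Mat n d) (a k δ : ℕ) : Prop where
  lt : a < k
  pos : 0 < δ
  le : k + δ ≤ d + 1
  row0 : ∀ c : Fin (d + 1), M 0 c =
    (if (c : ℕ) < a then Entry.delta else if (c : ℕ) < k then Entry.mu else Entry.R)
  row1_mu : ∀ c : Fin (d + 1), a + δ ≤ c → (c : ℕ) < k + δ → M 1 c = Entry.mu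
  row1_R : ∀ c : Fin (d + 1), M 1 c = Entry.R ↔ k + δ ≤ c
  muIn1_eq : muIn1 M = a + δ
  -- A `mu` to the left of the matched columns could only stand in the place of `ζ`, and for `n = 1`
  -- that symbol is `delta`.
  unmatched : n = 1 → ∀ c : Fin (d + 1), M 1 c = Entry.mu → a + δ ≤ c

theorem muIn0_eq {n d : ℕ} {M : Mat n d} {a k : ℕ} (hak : a < k) (hk : k ≤ d + 1)
    (h : ∀ c : Fin (d + 1), M 0 c =
      (if (c : ℕ) < a then Entry.delta else if (c : ℕ) < k then Entry.mu else Entry.R)) :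
    muIn0 M = a := by
  have hmem : a ∈ {i : ℕ | ∃ c : Fin (d + 1), (c : ℕ) = i ∧ M 0 c = Entry.mu} :=
    ⟨⟨a, hak.trans_le hk⟩, rfl, by simp [h, hak]⟩
  apply le_antisymm
  · exact Nat.sInf_le hmem
  · obtain ⟨c, hc, hmu⟩ := Nat.sInf_mem ⟨a, hmem⟩
    rw [muIn0, ← hc]
    by_contra hlt
    rw [h, if_pos (not_le.1 hlt)] at hmu
    cases hmu

theorem IsZeta.ne_R {n : ℕ} {ζ : Entry} (h : IsZeta n ζ) : ζ ≠ Entry.R := by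
  rintro rfl
  simp [IsZeta] at h

theorem IsFRT2.exists_muBlock {n d : ℕ} {M : Mat n d} (h : IsFRT2 M) :
    ∃ a k δ, MuBlock M a k δ := by
  have h' := h
  obtain ⟨i, k, ζ, hik, hk, hζ, hM⟩ := h'
  have h0 := fun c => (hM c).1
  refine ⟨i, k, 1, hik, one_pos, by omega, h0, ?_, ?_, ?_, ?_⟩
  · intro c h₁ h₂
    rw [(hM c).2, if_neg (by omega), if_neg (by omega), if_pos (by omega)]
  · intro c
    have := hζ.ne_R
    rw [(hM c).2]
    split_ifs <;> simp_all <;> omega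
  · rw [muIn1, if_pos h, muIn0_eq hik (by omega) h0]
  · intro hn c hc
    have := hζ.2 hn
    rw [(hM c).2] at hc
    split_ifs at hc
    · rw [this] at hc
      cases hc
    · omega

theorem IsFRT4.exists_muBlock {n d : ℕ} {M : Mat n d} (h : IsFRT4 M) :
    ∃ a k δ, MuBlock M a k δ := by
  obtain ⟨k, l, hk0, hkl, hl, hM⟩ := h
  have h0 : ∀ c : Fin (d + 1), M 0 c =
      (if (c : ℕ) < k - 1 then Entry.delta else if (c : ℕ) < k then Entry.mu else Entry.R) := by
    intro c
    rw [(hM c).1]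
    split_ifs <;> first | rfl | omega
  have h1 : ∀ c : Fin (d + 1), M 1 c = Entry.R ↔ l ≤ c := by
    intro c
    rw [(hM c).2]
    split_ifs <;> simp <;> omega
  -- `muIn1` branches on the second type, so the two types must be told apart: the `R` regions of
  -- rows `0` and `1` start one column apart in the second type, and at least two apart in the
  -- fourth.
  have hn2 : ¬ IsFRT2 M := by
    rintro ⟨i, k', ζ, hik, hk', -, hM'⟩
    have e₁ : minR M 0 = k := minR_eq (by omega) fun c => by
      rw [h0]
      split_ifs <;> simp <;> omega
    have e₂ : minR M 0 = k' := minR_eq (by omega) fun c => by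
      rw [(hM' c).1]
      split_ifs <;> simp <;> omega
    have hc := (h1 ⟨k', by omega⟩).not.2 (by simp; omega)
    have e₃ := (h1 ⟨l - 1, by omega⟩).not.2 (by simp; omega)
    rw [(hM' _).2, if_neg (by simp; omega), if_neg (by simp; omega), if_neg (by simp; omega)] at e₃
    exact e₃ rfl
  refine ⟨k - 1, k, l - k, by omega, by omega, by omega, h0, ?_, ?_, ?_, ?_⟩
  · intro c h₁ h₂
    rw [(hM c).2, if_neg (by omega), if_pos (by omega)]
  · intro c
    rw [h1]
    omega
  · rw [muIn1, if_neg hn2, minR_eq hl h1]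
    omega
  · intro hn c hc
    rw [(hM c).2] at hc
    split_ifs at hc
    omega

theorem exists_muBlock {n d : ℕ} {M : Mat n d} (h : IsFRT2 M ∨ IsFRT4 M) :
    ∃ a k δ, MuBlock M a k δ :=
  h.elim IsFRT2.exists_muBlock IsFRT4.exists_muBlock

namespace MuBlock

variable {n d a k δ : ℕ} {M : Mat n d}

theorem row0_R (h : MuBlock M a k δ) (c : Fin (d + 1)) : M 0 c = Entry.R ↔ k ≤ c := by
  have := h.lt
  rw [h.row0]
  split_ifs <;> simp <;> omega

theorem row0_mu (h : MuBlock M a k δ) (c : Fin (d + 1)) :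
    M 0 c = Entry.mu ↔ a ≤ c ∧ (c : ℕ) < k := by
  rw [h.row0]
  split_ifs <;> simp <;> omega

theorem minR_zero (h : MuBlock M a k δ) : minR M 0 = k :=
  minR_eq (by have := h.le; omega) h.row0_R

theorem minR_one (h : MuBlock M a k δ) : minR M 1 = k + δ :=
  minR_eq h.le h.row1_R

theorem muIn0 (h : MuBlock M a k δ) : TwistedPartition.muIn0 M = a :=
  muIn0_eq h.lt (by have := h.le; omega) h.row0

end MuBlock

/-! ### The possible entries of each row of an fC-matrix. -/

namespace IsFC

variable {n d : ℕ} {M : Mat n d}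

theorem R_iff_zero (h : IsFC M) (c : Fin (d + 1)) : M 0 c = Entry.R ↔ minR M 0 ≤ c := by
  suffices H : ∃ k ≤ d + 1, ∀ c : Fin (d + 1), M 0 c = Entry.R ↔ k ≤ c by
    obtain ⟨k, hk, H⟩ := H
    rw [minR_eq hk H, H]
  rcases h.rows01 with ⟨k, hk, hM⟩ | h2 | ⟨k, l, ζ, hk, hl, -, hM⟩ | h4
  · refine ⟨k, hk, fun c => ?_⟩
    rw [(hM c).1]
    split_ifs <;> simp <;> omega
  · obtain ⟨a, k, δ, hb⟩ := h2.exists_muBlock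
    exact ⟨k, by have := hb.le; omega, hb.row0_R⟩
  · refine ⟨k, by omega, fun c => ?_⟩
    rw [(hM c).1]
    split_ifs <;> simp <;> omega
  · obtain ⟨a, k, δ, hb⟩ := h4.exists_muBlock
    exact ⟨k, by have := hb.le; omega, hb.row0_R⟩

theorem R_iff_one (h : IsFC M) (c : Fin (d + 1)) : M 1 c = Entry.R ↔ minR M 1 ≤ c := by
  suffices H : ∃ k ≤ d + 1, ∀ c : Fin (d + 1), M 1 c = Entry.R ↔ k ≤ c by
    obtain ⟨k, hk, H⟩ := H
    rw [minR_eq hk H, H]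
  rcases h.rows01 with ⟨k, hk, hM⟩ | h2 | ⟨k, l, ζ, hk, hl, hζ, hM⟩ | h4
  · refine ⟨k, hk, fun c => ?_⟩
    rw [(hM c).2]
    split_ifs <;> simp <;> omega
  · obtain ⟨a, k, δ, hb⟩ := h2.exists_muBlock
    exact ⟨_, hb.le, hb.row1_R⟩
  · refine ⟨l, by omega, fun c => ?_⟩
    have := hζ.ne_R
    rw [(hM c).2]
    split_ifs <;> simp_all <;> omega
  · obtain ⟨a, k, δ, hb⟩ := h4.exists_muBlock
    exact ⟨_, hb.le, hb.row1_R⟩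

theorem row_zero (h : IsFC M) (c : Fin (d + 1)) :
    M 0 c = Entry.delta ∨ M 0 c = Entry.R ∨
      (M 0 c = Entry.mu ∧ (IsFRT2 M ∨ IsFRT4 M)) := by
  rcases h.rows01 with ⟨k, hk, hM⟩ | h2 | ⟨k, l, ζ, hk, hl, -, hM⟩ | h4
  · rw [(hM c).1]
    split_ifs <;> simp
  · obtain ⟨a, k, δ, hb⟩ := h2.exists_muBlock
    rw [hb.row0]
    split_ifs <;> simp [h2]
  · rw [(hM c).1]
    split_ifs <;> simp
  · obtain ⟨a, k, δ, hb⟩ := h4.exists_muBlock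
    rw [hb.row0]
    split_ifs <;> simp [h4]

/-- The symbols `μ↑` and `μ↓` stand in at most one place of row `1`, and only for `n ≠ 1`; the
symbols `μ` for `n = 1` are matched with those of row `0`. -/
theorem row_one (h : IsFC M) (c : Fin (d + 1)) :
    M 1 c = Entry.delta ∨ M 1 c = Entry.R ∨
      (M 1 c = Entry.mu ∧ (n = 1 → IsFRT2 M ∨ IsFRT4 M)) ∨
      (M 1 c = Entry.muUp ∧ n ≠ 1 ∧ ∀ c', M 1 c' = Entry.muUp → c' = c) ∨
      (M 1 c = Entry.muDown ∧ n ≠ 1 ∧ ∀ c', M 1 c' = Entry.muDown → c' = c) := by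
  have zeta : ∀ {ζ : Entry} {i : ℕ}, IsZeta n ζ → (c : ℕ) = i → M 1 c = ζ →
      (∀ c' : Fin (d + 1), (c' : ℕ) ≠ i → M 1 c' ≠ Entry.muUp ∧ M 1 c' ≠ Entry.muDown) →
      M 1 c = Entry.delta ∨ M 1 c = Entry.R ∨
      (M 1 c = Entry.mu ∧ (n = 1 → IsFRT2 M ∨ IsFRT4 M)) ∨
      (M 1 c = Entry.muUp ∧ n ≠ 1 ∧ ∀ c', M 1 c' = Entry.muUp → c' = c) ∨
      (M 1 c = Entry.muDown ∧ n ≠ 1 ∧ ∀ c', M 1 c' = Entry.muDown → c' = c) := by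
    rintro ζ i ⟨hζ, hn⟩ rfl rfl hne
    have hup : ∀ c' : Fin (d + 1), M 1 c' = Entry.muUp → c' = c := fun c' hc' => by
      by_contra hcc
      exact (hne c' (fun h => hcc (Fin.ext h))).1 hc'
    have hdown : ∀ c' : Fin (d + 1), M 1 c' = Entry.muDown → c' = c := fun c' hc' => by
      by_contra hcc
      exact (hne c' (fun h => hcc (Fin.ext h))).2 hc'
    rcases hζ with hζ | hζ | hζ | hζ
    · refine Or.inr (Or.inr (Or.inl ⟨hζ, fun h1 => ?_⟩))
      rw [hn h1] at hζ
      cases hζ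
    · refine Or.inr (Or.inr (Or.inr (Or.inl ⟨hζ, fun h1 => ?_, hup⟩)))
      rw [hn h1] at hζ
      cases hζ
    · refine Or.inr (Or.inr (Or.inr (Or.inr ⟨hζ, fun h1 => ?_, hdown⟩)))
      rw [hn h1] at hζ
      cases hζ
    · exact Or.inl hζ
  rcases h.rows01 with ⟨k, hk, hM⟩ | h2 | ⟨k, l, ζ, hk, hl, hζ, hM⟩ | h4
  · rw [(hM c).2]
    split_ifs <;> simp
  · obtain ⟨i, k, ζ, hik, hk, hζ, hM⟩ := id h2
    by_cases hc : (c : ℕ) = i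
    · refine zeta hζ hc (by rw [(hM c).2, if_neg (by omega), if_pos hc]) fun c' hc' => ?_
      rw [(hM c').2]
      split_ifs <;> simp
    · rw [(hM c).2, if_neg hc]
      split_ifs <;> simp [h2]
  · by_cases hc : (c : ℕ) = l - 1
    · refine zeta hζ hc (by rw [(hM c).2, if_neg (by omega), if_pos (by omega)]) fun c' hc' => ?_
      rw [(hM c').2, if_neg (show ¬ (c' : ℕ) + 1 = l by omega)]
      split_ifs <;> simp
    · rw [(hM c).2, if_neg (show ¬ (c : ℕ) + 1 = l by omega)]
      split_ifs <;> simp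
  · obtain ⟨k, l, -, -, -, hM⟩ := id h4
    rw [(hM c).2]
    split_ifs <;> simp [h4]

theorem row_ge_two (h : IsFC M) {q : Fin (n + 1)} (hq : 2 ≤ (q : ℕ)) (c : Fin (d + 1)) :
    M q c = Entry.delta ∨ M q c = Entry.R ∨
      ∃ N : Subgroup (Equiv.Perm (Fin (q : ℕ))), N.Normal ∧ N ≠ ⊥ ∧ M q c = Entry.sub q N := by
  obtain ⟨i, k, N, -, -, hN, -, hM⟩ := h.rows q hq
  rw [hM]
  split_ifs with h₁ h₂
  · exact Or.inl rfl
  · have := hN c (not_lt.1 h₁) h₂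
    exact Or.inr (Or.inr ⟨_, this.1, this.2, rfl⟩)
  · exact Or.inr (Or.inl rfl)

end IsFC

/-! ### Test elements and links between rows `0` and `1`. -/

variable {n d : ℕ} {M M₁ M₂ : Mat n d}

theorem row_ofPerm {q : Fin (n + 1)} (π : Equiv.Perm (Fin (q : ℕ))) :
    row (ofPerm (Nat.lt_succ_iff.1 q.2) π) = q :=
  Fin.ext (rank_ofPerm _ π)

/-- For `n = 0` the numeral would wrap around to `0`. -/
theorem val_one_of_pos (hn : 1 ≤ n) : ((1 : Fin (n + 1)) : ℕ) = 1 := by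
  obtain ⟨m, rfl⟩ := Nat.exists_eq_add_of_le' hn
  rfl

theorem row_partialPerm_empty (σ : Equiv.Perm (Fin n)) : row (partialPerm ∅ σ) = 0 :=
  Fin.ext (by simp [row, rank_partialPerm])

theorem row_partialPerm_singleton (hn : 1 ≤ n) (x : Fin n) (σ : Equiv.Perm (Fin n)) :
    row (partialPerm {x} σ) = 1 :=
  Fin.ext ((rank_partialPerm _ σ).trans
    ((Set.ncard_singleton x).trans (val_one_of_pos hn).symm))

theorem ne_of_row (hn : 1 ≤ n) {α β : PartMon n} (hα : row α = 0) (hβ : row β = 1) : α ≠ β := by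
  rintro rfl
  have := congrArg Fin.val (hα.symm.trans hβ)
  rw [val_one_of_pos hn] at this
  simp at this

theorem Entry.le.eq_or_eq_R {e : Entry} (h : Entry.le Entry.mu e) :
    e = Entry.mu ∨ e = Entry.R := by
  cases h <;> simp

/-- Matched entries `μ` in rows `0` and `1` give pairs of related elements. -/
def Linked (M : Mat n d) (i j : Fin (d + 1)) : Prop :=
  (M 0 i = Entry.R ∧ M 1 j = Entry.R) ∨
    (M 0 i = Entry.mu ∧ M 1 j = Entry.mu ∧
      ((i : ℕ) : ℤ) - ((j : ℕ) : ℤ) = (minR M 0 : ℤ) - (minR M 1 : ℤ))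

/-- Only the `R` and `mu` clauses can relate different ranks here: row `0` contains no other symbol
than these and `delta`, and `delta` forces equality. -/
theorem CgRel.linked (hn : 1 ≤ n) (hM : IsFC M) {i j : Fin (d + 1)} {α β : PartMon n}
    (hα : row α = 0) (hβ : row β = 1) (h : CgRel M (Twisted.mk i α) (Twisted.mk j β)) :
    Linked M i j := by
  have hne := ne_of_row hn hα hβ
  have h0 := hM.row_zero i
  cases h with
  | fC1 _ _ _ h => exact absurd h hne
  | fC2 h₁ h₂ => exact Or.inl ⟨hα ▸ h₁, hβ ▸ h₂⟩
  | fC3 h₁ => rw [hα] at h₁; simp [h₁] at h0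
  | fC4 h₁ => rw [hα] at h₁; simp [h₁] at h0
  | fC5 h₁ => rw [hα] at h₁; simp [h₁] at h0
  | fC6 h₁ h₂ _ h =>
    rw [hα, hβ] at h
    refine Or.inr ⟨hα ▸ h₁, hβ ▸ h₂, h.resolve_left ?_⟩
    rintro ⟨h, -⟩
    exact ne_of_row hn hα (hα.trans h) rfl

/-- A single test pair suffices, the empty partial permutation and one with a single transversal. -/
theorem Linked.of_subset (hn : 1 ≤ n) (h₂ : IsFC M₂) (h : cg M₁ ⊆ cg M₂) {i j : Fin (d + 1)}
    (hl : Linked M₁ i j) : Linked M₂ i j := by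
  have e0 := row_partialPerm_empty (n := n) 1
  have e1 := row_partialPerm_singleton hn ⟨0, hn⟩ 1
  refine CgRel.linked hn h₂ e0 e1 (@h (_, _) ?_)
  rcases hl with ⟨hi, hj⟩ | ⟨hi, hj, hij⟩
  · exact CgRel.fC2 (by rwa [e0]) (by rwa [e1])
  · exact CgRel.fC6 (by rwa [e0]) (by rwa [e1])
      ((hat_partialPerm _ _).trans (hat_partialPerm _ _).symm) (Or.inr (by rwa [e0, e1]))

theorem MuBlock.linked {a k δ : ℕ} (hb : MuBlock M a k δ) {i j : Fin (d + 1)} (hai : a ≤ i)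
    (hik : (i : ℕ) < k) (hij : (j : ℕ) = i + δ) : Linked M i j := by
  refine Or.inr ⟨(hb.row0_mu i).2 ⟨hai, hik⟩, hb.row1_mu j (by omega) (by omega), ?_⟩
  rw [hb.minR_zero, hb.minR_one, hij]
  push_cast
  ring

/-! ### Inclusion implies comparability -/

/-- Only an `R` entry relates a nonzero element to zero. -/
theorem R_of_subset (h : cg M₁ ⊆ cg M₂) {q : Fin (n + 1)} {c : Fin (d + 1)}
    (hq : M₁ q c = Entry.R) : M₂ q c = Entry.R := by
  have hrow := row_ofPerm (q := q) 1
  have hmem : CgRel M₂ (Twisted.mk c (ofPerm (Nat.lt_succ_iff.1 q.2) 1)) Twisted.zero :=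
    @h (_, _) (CgRel.fC7_left (by rwa [hrow]))
  cases hmem with
  | fC7_left h => rwa [hrow] at h

theorem le_of_subset_of_sub (h₂ : IsFC M₂) (h : cg M₁ ⊆ cg M₂) {q : Fin (n + 1)}
    (hq : 2 ≤ (q : ℕ)) {c : Fin (d + 1)} {N : Subgroup (Equiv.Perm (Fin (q : ℕ)))} (hN : N ≠ ⊥)
    (hc : M₁ q c = Entry.sub q N) : Entry.le (Entry.sub q N) (M₂ q c) := by
  have hrow := row_ofPerm (q := q)
  have key : ∀ π ∈ N, CgRel M₂ (Twisted.mk c (ofPerm (Nat.lt_succ_iff.1 q.2) 1))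
      (Twisted.mk c (ofPerm (Nat.lt_succ_iff.1 q.2) π)) := fun π hπ =>
    @h (_, _) (CgRel.fC3 (by rwa [hrow]) (by rwa [hrow]) rfl (greenH_ofPerm _ _ _)
      ⟨π, hπ, isPermDiff_ofPerm _ π⟩)
  rcases h₂.row_ge_two hq c with hd | hR | ⟨N', hN', -, hs⟩
  -- A nonidentity `π` gives two distinct related elements, which a `delta` entry does not allow.
  · obtain ⟨π, hπ, hne⟩ := N.bot_or_exists_ne_one.resolve_left hN
    have := key π hπ
    cases this with
    | fC1 _ _ _ h => exact absurd (ofPerm_injective _ h).symm hne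
    | fC2 h' => rw [hrow, hd] at h'; cases h'
    | fC3 h' => rw [hrow, hd] at h'; cases h'
    | fC4 h' => rw [hrow, hd] at h'; cases h'
    | fC5 h' => rw [hrow, hd] at h'; cases h'
    | fC6 h' => rw [hrow, hd] at h'; cases h'
  · rw [hR]
    exact Entry.le.top _
  · rw [hs]
    refine Entry.le.sub fun π hπ => ?_
    have := key π hπ
    cases this with
    | fC1 _ _ _ h => rw [← ofPerm_injective _ h]; exact N'.one_mem
    | fC2 h' => rw [hrow, hs] at h'; cases h'
    | fC3 h' _ _ _ hd =>
      rw [hrow, hs] at h'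
      cases h'
      obtain ⟨ρ, hρ, hd⟩ := hd
      obtain ⟨g, hg⟩ := isConj_iff.1 hd.isConj
      rw [← hg]
      exact hN'.conj_mem ρ hρ g
    | fC4 h' => rw [hrow, hs] at h'; cases h'
    | fC5 h' => rw [hrow, hs] at h'; cases h'
    | fC6 h' => rw [hrow, hs] at h'; cases h'

/-- Two distinct related elements of rank `1` in the same column. -/
theorem row_one_of_cgRel (h₂ : IsFC M₂) {c : Fin (d + 1)} {α β : PartMon n}
    (hα : row α = 1) (hne : α ≠ β) (h : CgRel M₂ (Twisted.mk c α) (Twisted.mk c β)) :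
    M₂ 1 c = Entry.R ∨ M₂ 1 c = Entry.mu ∨ (M₂ 1 c = Entry.muDown ∧ GreenL α β) ∨
      (M₂ 1 c = Entry.muUp ∧ GreenR α β) := by
  have h1 := h₂.row_one c
  cases h with
  | fC1 _ _ _ h => exact absurd h hne
  | fC2 h => exact Or.inl (hα ▸ h)
  | fC3 h => rw [hα] at h; simp [h] at h1
  | fC4 h _ _ h' => exact Or.inr (Or.inr (Or.inl ⟨hα ▸ h, h'⟩))
  | fC5 h _ _ h' => exact Or.inr (Or.inr (Or.inr ⟨hα ▸ h, h'⟩))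
  | fC6 h => exact Or.inr (Or.inl (hα ▸ h))

/-- With two points `x ≠ y`, the element with transversal `{x, x'}` is compared with those with `{y,
y'}` (neither `ℛ` nor `ℒ`), `{x, y'}` (`ℛ` only) and `{y, x'}` (`ℒ` only). Each pair rules out
exactly the symbols that are not above the given one. -/
theorem le_row_one_of_subset (hn : 2 ≤ n) (h₂ : IsFC M₂) (h : cg M₁ ⊆ cg M₂)
    {c : Fin (d + 1)} (hc : M₁ 1 c = Entry.mu ∨ M₁ 1 c = Entry.muUp ∨ M₁ 1 c = Entry.muDown) :
    Entry.le (M₁ 1 c) (M₂ 1 c) := by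
  have hn1 : 1 ≤ n := by omega
  have hrow := row_partialPerm_singleton hn1
  let x : Fin n := ⟨0, by omega⟩
  let y : Fin n := ⟨1, hn⟩
  have hxy : x ≠ y := by simp [x, y]
  have hhat : ∀ S T σ τ, hat (partialPerm (n := n) S σ) = hat (partialPerm T τ) :=
    fun S T σ τ => (hat_partialPerm _ _).trans (hat_partialPerm _ _).symm
  have notL : ∀ z τ, τ z ≠ x → ¬ GreenL (partialPerm {x} 1) (partialPerm {z} τ) := by
    intro z τ hz hL
    obtain ⟨w, hw, hτ⟩ := hL.exists_of_partialPerm (Set.mem_singleton x)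
    rw [Set.mem_singleton_iff.1 hw] at hτ
    exact hz hτ
  have notR : ∀ τ, ¬ GreenR (partialPerm {x} 1) (partialPerm {y} τ) := fun τ hR =>
    hxy (Set.mem_singleton_iff.1 (hR.mem_of_partialPerm (Set.mem_singleton x)))
  have hR : GreenR (partialPerm {x} 1) (partialPerm {x} (Equiv.swap x y)) :=
    greenR_partialPerm _ _ _
  have hL : GreenL (partialPerm {x} 1) (partialPerm {y} (Equiv.swap x y)) := by
    have := greenL_partialPerm {x} 1 (Equiv.swap x y)
    have hS : (Equiv.swap x y) ⁻¹' {x} = {y} := by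
      ext z
      rw [Set.mem_preimage, Set.mem_singleton_iff, Set.mem_singleton_iff,
        Equiv.swap_apply_eq_iff, Equiv.swap_apply_left]
    rwa [hS, one_mul] at this
  have neL : ∀ {α β : PartMon n}, ¬ GreenL α β → α ≠ β := by
    rintro α _ h rfl
    exact h rfl
  have neR : ∀ {α β : PartMon n}, ¬ GreenR α β → α ≠ β := by
    rintro α _ h rfl
    exact h rfl
  rcases hc with hc | hc | hc
  · have hm : CgRel M₂ (Twisted.mk c (partialPerm {x} 1)) (Twisted.mk c (partialPerm {y} 1)) :=
      @h (_, _) (CgRel.fC6 (by rwa [hrow]) (by rwa [hrow]) (hhat _ _ _ _)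
        (Or.inl ⟨by rw [hrow, hrow], rfl⟩))
    have nL := notL y 1 hxy.symm
    rw [hc]
    rcases row_one_of_cgRel h₂ (hrow _ _) (neL nL) hm with e | e | ⟨-, e⟩ | ⟨-, e⟩
    · rw [e]; exact Entry.le.top _
    · rw [e]; exact Entry.le.refl _
    · exact absurd e nL
    · exact absurd e (notR _)
  · have hm : CgRel M₂ (Twisted.mk c (partialPerm {x} 1))
        (Twisted.mk c (partialPerm {x} (Equiv.swap x y))) :=
      @h (_, _) (CgRel.fC5 (by rwa [hrow]) (by rwa [hrow]) (hhat _ _ _ _) hR)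
    have nL := notL x (Equiv.swap x y) (by rw [Equiv.swap_apply_left]; exact hxy.symm)
    rw [hc]
    rcases row_one_of_cgRel h₂ (hrow _ _) (neL nL) hm with e | e | ⟨-, e⟩ | ⟨e, -⟩
    · rw [e]; exact Entry.le.top _
    · rw [e]; exact Entry.le.up
    · exact absurd e nL
    · rw [e]; exact Entry.le.refl _
  · have hm : CgRel M₂ (Twisted.mk c (partialPerm {x} 1))
        (Twisted.mk c (partialPerm {y} (Equiv.swap x y))) :=
      @h (_, _) (CgRel.fC4 (by rwa [hrow]) (by rwa [hrow]) (hhat _ _ _ _) hL)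
    have nR := notR (Equiv.swap x y)
    rw [hc]
    rcases row_one_of_cgRel h₂ (hrow _ _) (neR nR) hm with e | e | ⟨e, -⟩ | ⟨-, e⟩
    · rw [e]; exact Entry.le.top _
    · rw [e]; exact Entry.le.down
    · rw [e]; exact Entry.le.refl _
    · exact absurd e nR

theorem Linked.mu_le_zero {i j : Fin (d + 1)} (h : Linked M i j) :
    Entry.le Entry.mu (M 0 i) := by
  rcases h with ⟨h, -⟩ | ⟨h, -, -⟩ <;> rw [h]
  · exact Entry.le.top _
  · exact Entry.le.refl _

theorem Linked.mu_le_one {i j : Fin (d + 1)} (h : Linked M i j) :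
    Entry.le Entry.mu (M 1 j) := by
  rcases h with ⟨-, h⟩ | ⟨-, h, -⟩ <;> rw [h]
  · exact Entry.le.top _
  · exact Entry.le.refl _

theorem row_eq_zero_or_one_or_two_le (hn : 1 ≤ n) (q : Fin (n + 1)) : q = 0 ∨ q = 1 ∨ 2 ≤ (q : ℕ) := by
  rcases Nat.lt_or_ge (q : ℕ) 2 with h | h
  · rcases Nat.lt_or_ge (q : ℕ) 1 with h' | h'
    · exact Or.inl (Fin.ext (Nat.lt_one_iff.1 h'))
    · exact Or.inr (Or.inl (Fin.ext (by rw [val_one_of_pos hn]; omega)))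
  · exact Or.inr (Or.inr h)

theorem leC_of_subset (hn : 1 ≤ n) (h₁ : IsFC M₁) (h₂ : IsFC M₂) (h : cg M₁ ⊆ cg M₂) :
    LeC M₁ M₂ := by
  intro q c
  have bot : M₁ q c = Entry.delta → Entry.le (M₁ q c) (M₂ q c) := fun e => by
    rw [e]; exact Entry.le.bot _
  have top : M₁ q c = Entry.R → Entry.le (M₁ q c) (M₂ q c) := fun e => by
    rw [R_of_subset h e]; exact Entry.le.top _
  rcases row_eq_zero_or_one_or_two_le hn q with rfl | rfl | hq
  · rcases h₁.row_zero c with e | e | ⟨e, ht⟩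
    · exact bot e
    · exact top e
    · obtain ⟨a, k, δ, hb⟩ := exists_muBlock ht
      have hc := (hb.row0_mu c).1 e
      have := hb.le
      -- Rank `0` elements with equal `hat` are equal, so nothing inside row `0` detects this `mu`;
      -- its partner in row `1` does.
      have hl := hb.linked (j := ⟨c + δ, by omega⟩) hc.1 hc.2 rfl
      rw [e]
      exact (hl.of_subset hn h₂ h).mu_le_zero
  · rcases h₁.row_one c with e | e | ⟨e, ht⟩ | ⟨e, hn', -⟩ | ⟨e, hn', -⟩
    · exact bot e
    · exact top e
    · rcases hn.eq_or_lt with hn' | hn'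
      · obtain ⟨a, k, δ, hb⟩ := exists_muBlock (ht hn'.symm)
        have hac := hb.unmatched hn'.symm c e
        have hck : (c : ℕ) < k + δ := by
          by_contra hck
          rw [(hb.row1_R c).2 (by omega)] at e
          cases e
        -- For `n = 1` there is a single partition of rank `1`, so the partner in row `0` is used;
        -- the subtraction is exact because `a + δ ≤ c`.
        have hl := hb.linked (i := ⟨c - δ, by omega⟩) (j := c) (by simp; omega) (by simp; omega)
          (by simp; omega)
        rw [e]
        exact (hl.of_subset hn h₂ h).mu_le_one
      · exact le_row_one_of_subset hn' h₂ h (Or.inl e)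
    · exact le_row_one_of_subset (by omega) h₂ h (Or.inr (Or.inl e))
    · exact le_row_one_of_subset (by omega) h₂ h (Or.inr (Or.inr e))
  · rcases h₁.row_ge_two hq c with e | e | ⟨N, -, hN, e⟩
    · exact bot e
    · exact top e
    · rw [e]
      exact le_of_subset_of_sub h₂ h hq hN e

theorem matching_of_subset (hn : 1 ≤ n) (h₂ : IsFC M₂) (h : cg M₁ ⊆ cg M₂)
    (ht : IsFRT2 M₁ ∨ IsFRT4 M₁) :
    (minR M₂ 0 ≤ muIn0 M₁ ∧ minR M₂ 1 ≤ muIn1 M₁) ∨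
      ((IsFRT2 M₂ ∨ IsFRT4 M₂) ∧
        (minR M₂ 1 : ℤ) - (minR M₂ 0 : ℤ) = (minR M₁ 1 : ℤ) - (minR M₁ 0 : ℤ)) := by
  obtain ⟨a, k, δ, hb⟩ := exists_muBlock ht
  have hlt := hb.lt
  have hle := hb.le
  -- These are the first matched columns, `muIn0 M₁` and `muIn1 M₁`. Whether this link survives as a
  -- pair of `R` or as a pair of `mu` decides between the two alternatives.
  have hl := hb.linked (i := ⟨a, by omega⟩) (j := ⟨a + δ, by omega⟩) le_rfl hlt rfl
  rw [hb.muIn0, hb.muIn1_eq, hb.minR_zero, hb.minR_one]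
  rcases hl.of_subset hn h₂ h with ⟨e₀, e₁⟩ | ⟨e₀, -, hd⟩
  · exact Or.inl ⟨(h₂.R_iff_zero _).1 e₀, (h₂.R_iff_one _).1 e₁⟩
  · refine Or.inr ⟨?_, ?_⟩
    · rcases h₂.row_zero ⟨a, by omega⟩ with e | e | ⟨-, ht⟩
      · rw [e] at e₀; cases e₀
      · rw [e] at e₀; cases e₀
      · exact ht
    · push_cast at hd ⊢
      linarith

/-! ### Comparability implies inclusion -/

theorem Linked.of_le (h₁ : IsFC M₁) (h₂ : IsFC M₂) (hle : LeC M₁ M₂)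
    (hmatch : (IsFRT2 M₁ ∨ IsFRT4 M₁) → (minR M₂ 0 ≤ muIn0 M₁ ∧ minR M₂ 1 ≤ muIn1 M₁) ∨
      ((IsFRT2 M₂ ∨ IsFRT4 M₂) ∧
        (minR M₂ 1 : ℤ) - (minR M₂ 0 : ℤ) = (minR M₁ 1 : ℤ) - (minR M₁ 0 : ℤ)))
    {i j : Fin (d + 1)} (hi : M₁ 0 i = Entry.mu) (hj : M₁ 1 j = Entry.mu)
    (hij : ((i : ℕ) : ℤ) - ((j : ℕ) : ℤ) = (minR M₁ 0 : ℤ) - (minR M₁ 1 : ℤ)) :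
    Linked M₂ i j := by
  have ht : IsFRT2 M₁ ∨ IsFRT4 M₁ := by
    rcases h₁.row_zero i with e | e | ⟨-, ht⟩
    · rw [e] at hi; cases hi
    · rw [e] at hi; cases hi
    · exact ht
  have hm := hmatch ht
  obtain ⟨a, k, δ, hb⟩ := exists_muBlock ht
  have hai := ((hb.row0_mu i).1 hi).1
  rw [hb.minR_zero, hb.minR_one] at hij
  rw [hb.muIn0, hb.muIn1_eq, hb.minR_zero, hb.minR_one] at hm
  have l₀ := hle 0 i
  have l₁ := hle 1 j
  rw [hi] at l₀
  rw [hj] at l₁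
  rcases hm with ⟨m₀, m₁⟩ | ⟨-, hd⟩
  · exact Or.inl ⟨(h₂.R_iff_zero i).2 (by omega), (h₂.R_iff_one j).2 (by omega)⟩
  -- Equal offsets put `i` and `j` at the same distance from the starts of the `R` regions of their
  -- rows in `M₂`.
  · have hR : M₂ 0 i = Entry.R ↔ M₂ 1 j = Entry.R := by
      rw [h₂.R_iff_zero, h₂.R_iff_one]
      omega
    rcases l₀.eq_or_eq_R with e₀ | e₀
    · rcases l₁.eq_or_eq_R with e₁ | e₁
      · exact Or.inr ⟨e₀, e₁, by omega⟩
      · exact Or.inl ⟨hR.2 e₁, e₁⟩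
    · exact Or.inl ⟨e₀, hR.1 e₀⟩

theorem row_eq_one_of_muDown_or_muUp (hn : 1 ≤ n) (hM : IsFC M) {q : Fin (n + 1)} {c : Fin (d + 1)}
    (h : M q c = Entry.muDown ∨ M q c = Entry.muUp) : q = 1 := by
  rcases row_eq_zero_or_one_or_two_le hn q with rfl | rfl | hq
  · have := hM.row_zero c
    rcases h with h | h <;> simp [h] at this
  · rfl
  · rcases hM.row_ge_two hq c with e | e | ⟨N, -, -, e⟩ <;> simp [e] at h

theorem row_of_mu (hn : 1 ≤ n) (hM : IsFC M) {q : Fin (n + 1)} {c : Fin (d + 1)}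
    (h : M q c = Entry.mu) : q = 0 ∨ q = 1 := by
  rcases row_eq_zero_or_one_or_two_le hn q with rfl | rfl | hq
  · exact Or.inl rfl
  · exact Or.inr rfl
  · rcases hM.row_ge_two hq c with e | e | ⟨N, -, -, e⟩ <;> simp [e] at h

theorem row_of_sub (hn : 1 ≤ n) (hM : IsFC M) {q : Fin (n + 1)} {c : Fin (d + 1)} {r : ℕ}
    {N : Subgroup (Equiv.Perm (Fin r))} (h : M q c = Entry.sub r N) : (q : ℕ) = r := by
  rcases row_eq_zero_or_one_or_two_le hn q with rfl | rfl | hq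
  · have := hM.row_zero c
    simp [h] at this
  · have := hM.row_one c
    simp [h] at this
  · rcases hM.row_ge_two hq c with e | e | ⟨N, -, -, e⟩
    · rw [e] at h; cases h
    · rw [e] at h; cases h
    · rw [e] at h
      exact (Entry.sub.inj h).1

/-- Any enumeration of the transversals, cut into upper and lower parts, serves; the upper parts are
distinct because they are nonempty pieces of disjoint blocks. -/
theorem isPermDiff_self {α : PartMon n} {q : ℕ} (hq : rank α = q) :
    IsPermDiff α α (1 : Equiv.Perm (Fin q)) := by
  have e : Fin q ≃ transversals α :=
    (finCongr hq.symm).trans (Finite.equivFinOfCardEq (Nat.card_coe_set_eq _)).symm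
  have hblock : transversals α = Set.range
      (fun t => Sum.inl '' (Sum.inl ⁻¹' (e t).1) ∪ Sum.inr '' (Sum.inr ⁻¹' (e t).1)) := by
    have : ∀ t, Sum.inl '' (Sum.inl ⁻¹' (e t).1) ∪ Sum.inr '' (Sum.inr ⁻¹' (e t).1) = (e t).1 :=
      fun t => Set.image_preimage_inl_union_image_preimage_inr _
    simp only [this]
    exact (Subtype.range_coe.symm.trans (e.surjective.range_comp _).symm)
  refine ⟨fun t => Sum.inl ⁻¹' (e t).1, fun t => Sum.inr ⁻¹' (e t).1, ?_, hblock, hblock⟩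
  intro s t hst
  apply e.injective
  apply Subtype.ext
  obtain ⟨x, hx⟩ := (e s).2.2.1
  have hx' : x ∈ Sum.inl ⁻¹' (e t).1 := hst.subset hx
  exact Setoid.eq_of_mem_classes (e s).2.1 hx (e t).2.1 hx'

/-- A `delta` entry may lie below any symbol, so its diagonal pairs need reflexivity under every
clause. -/
theorem IsFC.cgRel_refl (hM : IsFC M) (hn : 1 ≤ n) (c : Fin (d + 1)) (α : PartMon n) :
    CgRel M (Twisted.mk c α) (Twisted.mk c α) := by
  cases e : M (row α) c with
  | delta => exact CgRel.fC1 e e rfl rfl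
  | R => exact CgRel.fC2 e e
  | muUp => exact CgRel.fC5 e e rfl rfl
  | muDown => exact CgRel.fC4 e e rfl rfl
  | mu => exact CgRel.fC6 e e rfl (Or.inl ⟨rfl, rfl⟩)
  | sub q N =>
    exact CgRel.fC3 e e rfl ⟨rfl, rfl⟩ ⟨1, N.one_mem, isPermDiff_self (row_of_sub hn hM e)⟩

theorem subset_of_le (hn : 1 ≤ n) (h₁ : IsFC M₁) (h₂ : IsFC M₂) (hle : LeC M₁ M₂)
    (hmatch : (IsFRT2 M₁ ∨ IsFRT4 M₁) → (minR M₂ 0 ≤ muIn0 M₁ ∧ minR M₂ 1 ≤ muIn1 M₁) ∨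
      ((IsFRT2 M₂ ∨ IsFRT4 M₂) ∧
        (minR M₂ 1 : ℤ) - (minR M₂ 0 : ℤ) = (minR M₁ 1 : ℤ) - (minR M₁ 0 : ℤ))) :
    cg M₁ ⊆ cg M₂ := by
  have hR : ∀ {q c}, M₁ q c = Entry.R → M₂ q c = Entry.R := by
    intro q c hq
    have := hle q c
    rw [hq] at this
    generalize M₂ q c = e at this
    cases this <;> rfl
  rintro ⟨s, t⟩ hst
  change CgRel M₁ s t at hst
  change CgRel M₂ s t
  cases hst with
  | fC1 hα hβ hij h =>
    subst hij h
    exact h₂.cgRel_refl hn _ _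
  | fC2 hα hβ => exact CgRel.fC2 (hR hα) (hR hβ)
  | @fC3 i j α β q N hα hβ hij h hN =>
    subst hij
    have hrow : row α = row β := Fin.ext ((row_of_sub hn h₁ hα).trans (row_of_sub hn h₁ hβ).symm)
    have l := hle (row α) i
    rw [hα] at l
    generalize he : M₂ (row α) i = e at l
    cases l with
    | refl => exact CgRel.fC3 he (hrow ▸ he) rfl h hN
    | top => exact CgRel.fC2 he (hrow ▸ he)
    | sub hNN =>
      obtain ⟨π, hπ, hd⟩ := hN
      exact CgRel.fC3 he (hrow ▸ he) rfl h ⟨π, hNN hπ, hd⟩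
  | @fC4 i j α β hα hβ hhat h =>
    have rα := row_eq_one_of_muDown_or_muUp hn h₁ (Or.inl hα)
    have rβ := row_eq_one_of_muDown_or_muUp hn h₁ (Or.inl hβ)
    -- The clause does not ask for equal columns; they coincide because the symbol occurs at most
    -- once in row `1`.
    have hij : i = j := by
      rw [rα] at hα
      rw [rβ] at hβ
      have := h₁.row_one j
      simp only [hβ] at this
      simp at this
      exact this.2 i hα
    subst hij
    have hrow : row α = row β := rα.trans rβ.symm
    have l := hle (row α) i
    rw [hα] at l
    generalize he : M₂ (row α) i = e at l
    cases l with
    | refl => exact CgRel.fC4 he (hrow ▸ he) hhat h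
    | top => exact CgRel.fC2 he (hrow ▸ he)
    | down => exact CgRel.fC6 he (hrow ▸ he) hhat (Or.inl ⟨hrow, rfl⟩)
  | @fC5 i j α β hα hβ hhat h =>
    have rα := row_eq_one_of_muDown_or_muUp hn h₁ (Or.inr hα)
    have rβ := row_eq_one_of_muDown_or_muUp hn h₁ (Or.inr hβ)
    have hij : i = j := by
      rw [rα] at hα
      rw [rβ] at hβ
      have := h₁.row_one j
      simp only [hβ] at this
      simp at this
      exact this.2 i hα
    subst hij
    have hrow : row α = row β := rα.trans rβ.symm
    have l := hle (row α) i
    rw [hα] at l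
    generalize he : M₂ (row α) i = e at l
    cases l with
    | refl => exact CgRel.fC5 he (hrow ▸ he) hhat h
    | top => exact CgRel.fC2 he (hrow ▸ he)
    | up => exact CgRel.fC6 he (hrow ▸ he) hhat (Or.inl ⟨hrow, rfl⟩)
  | @fC6 i j α β hα hβ hhat h =>
    by_cases hrow : row α = row β
    -- Within one row the difference of minima vanishes, so both alternatives of the clause give
    -- equal columns.
    · have hij : i = j := by
        rcases h with ⟨-, h⟩ | h
        · exact h
        · rw [hrow] at h
          exact Fin.ext (by omega)
      subst hij
      have l := hle (row α) i
      rw [hα] at l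
      rcases l.eq_or_eq_R with e | e
      · exact CgRel.fC6 e (hrow ▸ e) hhat (Or.inl ⟨hrow, rfl⟩)
      · exact CgRel.fC2 e (hrow ▸ e)
    · have hd := h.resolve_left fun h => hrow h.1
      rcases row_of_mu hn h₁ hα with rα | rα <;> rcases row_of_mu hn h₁ hβ with rβ | rβ
      · exact absurd (rα.trans rβ.symm) hrow
      · rw [rα] at hα
        rw [rβ] at hβ
        rw [rα, rβ] at hd
        rcases Linked.of_le h₁ h₂ hle hmatch hα hβ hd with ⟨e₀, e₁⟩ | ⟨e₀, e₁, e⟩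
        · exact CgRel.fC2 (by rwa [rα]) (by rwa [rβ])
        · exact CgRel.fC6 (by rwa [rα]) (by rwa [rβ]) hhat (Or.inr (by rwa [rα, rβ]))
      · rw [rα] at hα
        rw [rβ] at hβ
        rw [rα, rβ] at hd
        rcases Linked.of_le h₁ h₂ hle hmatch hβ hα (by omega) with ⟨e₀, e₁⟩ | ⟨e₀, e₁, e⟩
        · exact CgRel.fC2 (by rwa [rα]) (by rwa [rβ])
        · exact CgRel.fC6 (by rwa [rα]) (by rwa [rβ]) hhat (Or.inr (by rw [rα, rβ]; omega))
      · exact absurd (rα.trans rβ.symm) hrow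
  | fC7_left h => exact CgRel.fC7_left (hR h)
  | fC7_right h => exact CgRel.fC7_right (hR h)
  | fC8 => exact CgRel.fC8

end TwistedPartition

theorem theorem7p4 (n d : ℕ) (hn : 1 ≤ n) (M₁ M₂ : TwistedPartition.Mat n d)
    (h₁ : TwistedPartition.IsFC M₁) (h₂ : TwistedPartition.IsFC M₂) :
    TwistedPartition.cg M₁ ⊆ TwistedPartition.cg M₂ ↔
      (TwistedPartition.LeC M₁ M₂ ∧
        ((TwistedPartition.IsFRT2 M₁ ∨ TwistedPartition.IsFRT4 M₁) →
          ((TwistedPartition.minR M₂ 0 ≤ TwistedPartition.muIn0 M₁ ∧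
              TwistedPartition.minR M₂ 1 ≤ TwistedPartition.muIn1 M₁) ∨
            ((TwistedPartition.IsFRT2 M₂ ∨ TwistedPartition.IsFRT4 M₂) ∧
              (TwistedPartition.minR M₂ 1 : ℤ) - (TwistedPartition.minR M₂ 0 : ℤ) =
                (TwistedPartition.minR M₁ 1 : ℤ) - (TwistedPartition.minR M₁ 0 : ℤ))))) := by
  open TwistedPartition in
  exact ⟨fun h => ⟨leC_of_subset hn h₁ h₂ h, matching_of_subset hn h₂ h⟩,
    fun h => subset_of_le hn h₁ h₂ h.1 h.2⟩
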